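/- Let $K=\mathbf{R}[[t^{\mathbf{R}}]]$ be the field of Hahn series with real coefficients and real exponents. It carries the valuation $v$ sending a nonzero series to its smallest exponent (and $v(0)=\infty$), and it is ordered by declaring a nonzero series positive when its leading coefficient is positive. Let $P=\sum_{i=0}^n c_ix^i\in K[x]$. Its Newton polygon is the lower convex hull of the points $(i,v(c_i))$ with $c_i\neq 0$; let $\sigma_1,\dots,\sigma_r$ be its bounded edges, with slopes $\lambda_1,\dots,\lambda_r$. For each $j$, let $P_j$ be the initial form of $P$ along $\sigma_j$, that is, the sum of those monomials $c_ix^i$ of $P$ for which $v(c_i)-\lambda_j i$ is minimal (equivalently, for which $(i,v(c_i))\in\sigma_j$). Let $\Delta(P_j)$ be the number of sign changes in the sequence of coefficients of $P_j$, zeros being ignored. Then, for every $j$, $\Delta(P_j)$ is congruent modulo $2$ to the number, counted with multiplicity, of roots of $P$ in $\mathbf{C}[[t^{\mathbf{R}}]]$ that have valuation $-\lambda_j$ and whose leading term $c\,t^{-\lambda_j}$ has a real and positive coefficient $c$. -/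

import Mathlib

open Polynomial

/-- The field `ℝ[[t^ℝ]]` of real Hahn series with real exponents. The type synonym `Lex` makes it
an ordered field: a nonzero series is positive when its leading coefficient is positive. -/
abbrev RealHahn : Type := Lex (HahnSeries ℝ ℝ)

/-- The field `ℂ[[t^ℝ]]` of complex Hahn series with real exponents. -/
abbrev ComplexHahn : Type := HahnSeries ℝ ℂ

noncomputable section

/-- The valuation of a real Hahn series: the least exponent, and `∞` for the zero series. -/
def RealHahn.val (x : RealHahn) : WithTop ℝ := (ofLex x).orderTop

/-- The inclusion of `ℝ[[t^ℝ]]` into `ℂ[[t^ℝ]]`, coefficient by coefficient. -/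
def RealHahn.toComplex : RealHahn →+* ComplexHahn where
  toFun x := (ofLex x).map Complex.ofRealHom
  map_zero' := by ext; simp
  map_one' := HahnSeries.map_one Complex.ofRealHom.toMonoidWithZeroHom
  map_add' _ _ := HahnSeries.map_add (Complex.ofRealHom : ℝ →+ ℂ)
  map_mul' _ _ := HahnSeries.map_mul (Complex.ofRealHom : ℝ →ₙ+* ℂ)

/-- The points `(i, v(c_i))` in the plane, for the nonzero coefficients `c_i` of `P`. -/
def newtonPoints (P : RealHahn[X]) : Set (ℝ × ℝ) :=
  {q | ∃ i : ℕ, q.1 = i ∧ (P.coeff i).val = (q.2 : WithTop ℝ)}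

/-- The Newton polygon of `P`: the lower convex hull of the points `(i, v(c_i))`, that is, the set
defined by the lower inequalities `b ≤ u₁ x₁ + u₂ x₂`, `0 ≤ u₂`, valid on their convex hull. -/
def newtonPolygon (P : RealHahn[X]) : Set (ℝ × ℝ) :=
  {x | ∀ u₁ u₂ b : ℝ, 0 ≤ u₂ →
    (∀ y ∈ convexHull ℝ (newtonPoints P), b ≤ u₁ * y.1 + u₂ * y.2) →
    b ≤ u₁ * x.1 + u₂ * x.2}

/-- `σ` is a (bounded) edge of slope `lam` of the Newton polygon of `P`: it has more than one point
and is cut out of the polygon by a supporting line of slope `lam`, below the polygon. -/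
def IsNewtonEdge (P : RealHahn[X]) (σ : Set (ℝ × ℝ)) (lam : ℝ) : Prop :=
  ∃ b : ℝ, (∀ x ∈ newtonPolygon P, lam * x.1 + b ≤ x.2) ∧
    σ = {x ∈ newtonPolygon P | x.2 = lam * x.1 + b} ∧ σ.Nontrivial

open Classical in
/-- The initial form `In_a(P)`: the sum of the monomials `c_i x^i` of `P` for which `v(c_i) + a i`
is minimal. On an edge of slope `lam` one takes `a = -lam`, which selects exactly the monomials with
`(i, v(c_i))` on the edge. -/
def initialForm (a : ℝ) (P : RealHahn[X]) : RealHahn[X] :=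
  ∑ i ∈ P.support with
    ∀ j : ℕ, (P.coeff i).val + ((a * i : ℝ) : WithTop ℝ) ≤
      (P.coeff j).val + ((a * j : ℝ) : WithTop ℝ),
    monomial i (P.coeff i)

/-- The leading term of the complex Hahn series `z` is `c t^r` with `c` a positive real number;
`r` is then the valuation of `z`. -/
def HasPosLeadingTerm (z : ComplexHahn) (r : ℝ) : Prop :=
  z.orderTop = (r : WithTop ℝ) ∧ ∃ c : ℝ, 0 < c ∧ z.leadingCoeff = (c : ℂ)

open Classical in
/-- The number of roots of `P` in `ℂ[[t^ℝ]]`, counted with multiplicity, that have valuation `r` and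
whose leading term is real and positive. -/
def numPosLeadingRoots (P : RealHahn[X]) (r : ℝ) : ℕ :=
  (P.map RealHahn.toComplex).roots.countP (fun z => HasPosLeadingTerm z r)

end

/-! Put `a = -λ_j` and substitute `x ↦ x t^a`. This turns `P` into a Hahn series with polynomial
coefficients (`weightedExpand`), of order `min (v(c_i) + a i)`. Its leading coefficient `q` is a
real polynomial whose coefficients have the same signs as those of the initial form
(`exists_real_initialForm`).

Taking leading coefficients is multiplicative and `ℂ[[t^ℝ]]` is algebraically closed, so `q` is the
product of the contributions of the linear factors `X - z` of `P`, up to a constant. Such a factor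
contributes a positive root exactly when `z` has leading term `c t^a` with `c > 0`. Hence the roots
to be counted are the positive roots of `q`, with multiplicity. For a real polynomial, the parities
of both the number of sign changes and the number of positive roots are read off from the signs of
the leading and trailing coefficients.

Algebraic closedness is proved by the Newton polygon method: a coprime factorization of an initial
form lifts by Hensel's lemma, and induction on the degree gives a root. -/

/-! ### Lifting factorizations to Hahn series -/

open Classical in
theorem HahnSeries.coeff_mul_of_support_subset {Γ R : Type*} [AddCommMonoid Γ] [PartialOrder Γ]
    [IsOrderedCancelAddMonoid Γ] [CommRing R] {S : Set Γ} (hS : S.IsPWO) {x y : HahnSeries Γ R}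
    (hx : x.support ⊆ S) (hy : y.support ⊆ S) (s : Γ) :
    (x * y).coeff s = ∑ p ∈ Finset.antidiagonal hS hS s, x.coeff p.1 * y.coeff p.2 := by
  rw [HahnSeries.coeff_mul]
  refine Finset.sum_subset (fun p hp => ?_) (fun p hp hp' => ?_)
  · simp only [Finset.mem_antidiagonal] at hp ⊢
    exact ⟨hx hp.1, hy hp.2.1, hp.2.2⟩
  · simp only [Finset.mem_antidiagonal, HahnSeries.mem_support] at hp hp'
    by_contra h
    exact hp' ⟨left_ne_zero_of_mul h, right_ne_zero_of_mul h, hp.2.2⟩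

open Classical in
/-- A factorization of the constant coefficient lifts to a Hahn series with nonnegative exponents,
provided that the linearized equation is solvable. -/
theorem HahnSeries.exists_eq_mul_of_coeff_zero_eq_mul {Γ R : Type*} [AddCommGroup Γ]
    [LinearOrder Γ] [IsOrderedAddMonoid Γ] [CommRing R] (F : HahnSeries Γ R)
    (hF : ∀ s < 0, F.coeff s = 0) (M₁ M₂ M : AddSubgroup R) (g h : R)
    (hg : g ∈ M₁) (hh : h ∈ M₂) (hgh : F.coeff 0 = g * h) (hM : ∀ s, F.coeff s ∈ M)
    (hmul : ∀ x ∈ M₁, ∀ y ∈ M₂, x * y ∈ M)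
    (hsol : ∀ w ∈ M, ∃ u ∈ M₁, ∃ v ∈ M₂, g * v + u * h = w) :
    ∃ G H : HahnSeries Γ R, F = G * H ∧ (∀ s, G.coeff s ∈ M₁) ∧ ∀ s, H.coeff s ∈ M₂ := by
  have hpos : ∀ s ∈ F.support, 0 ≤ s := fun s hs => by
    by_contra h
    exact hs (hF s (not_le.1 h))
  -- The exponents of both factors are sought in the monoid generated by the support of `F`. It is
  -- partially well-ordered because its generators are nonnegative, which allows recursion on
  -- exponents.
  set S : Set Γ := (AddSubmonoid.closure F.support : Set Γ) with hSdef
  have hS : S.IsPWO := Set.IsPWO.addSubmonoid_closure hpos F.isPWO_support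
  have hS0 : (0 : Γ) ∈ S := zero_mem (AddSubmonoid.closure F.support)
  have hSadd : ∀ a ∈ S, ∀ b ∈ S, a + b ∈ S := fun a ha b hb =>
    add_mem (S := AddSubmonoid Γ) ha hb
  have hFS : F.support ⊆ S := AddSubmonoid.subset_closure
  have hSnonneg : ∀ s ∈ S, 0 ≤ s := fun s hs =>
    AddSubmonoid.closure_induction (fun x hx => hpos x hx) le_rfl
      (fun x y _ _ hx hy => add_nonneg hx hy) hs
  have hwf : WellFounded fun a b : Γ => a < b ∧ a ∈ S ∧ b ∈ S :=
    Set.wellFoundedOn_iff.1 hS.isWF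
  have hsol' : ∀ w : R, ∃ p : M₁ × M₂, w ∈ M → g * p.2 + p.1 * h = w := fun w => by
    by_cases hw : w ∈ M
    · obtain ⟨u, hu, v, hv, e⟩ := hsol w hw
      exact ⟨(⟨u, hu⟩, ⟨v, hv⟩), fun _ => e⟩
    · exact ⟨0, fun h => absurd h hw⟩
  choose sol hsol using hsol'
  -- In the coefficient of `G * H` at `s`, the unknowns occur only in the pairs `(0, s)` and `(s,
  -- 0)`, contributing `g v + u h`. All other pairs have both entries below `s` and are already
  -- known.
  let step : (s : Γ) → ((t : Γ) → (t < s ∧ t ∈ S ∧ s ∈ S) → M₁ × M₂) → M₁ × M₂ := fun s prev =>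
    if s = 0 then (⟨g, hg⟩, ⟨h, hh⟩) else if s ∉ S then 0 else
      sol (F.coeff s - ∑ p ∈ Finset.antidiagonal hS hS s,
        if h : (p.1 < s ∧ p.1 ∈ S ∧ s ∈ S) ∧ (p.2 < s ∧ p.2 ∈ S ∧ s ∈ S) then
          ((prev p.1 h.1).1 : R) * (prev p.2 h.2).2 else 0)
  let W : Γ → M₁ × M₂ := hwf.fix step
  have hW : ∀ s, W s = step s fun t _ => W t := fun s => hwf.fix_eq step s
  have hW0 : W 0 = (⟨g, hg⟩, ⟨h, hh⟩) := by rw [hW]; simp [step]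
  have hWS : ∀ s ∉ S, W s = 0 := fun s hs => by
    have : s ≠ 0 := fun h => hs (h ▸ hS0)
    rw [hW]; simp [step, hs, this]
  let G : HahnSeries Γ R := ⟨fun s => (W s).1, hS.mono fun s hs => by
    by_contra h
    simp [hWS s h] at hs⟩
  let H : HahnSeries Γ R := ⟨fun s => (W s).2, hS.mono fun s hs => by
    by_contra h
    simp [hWS s h] at hs⟩
  have hGS : G.support ⊆ S := fun s hs => by
    by_contra h
    simp [G, hWS s h] at hs
  have hHS : H.support ⊆ S := fun s hs => by
    by_contra h
    simp [H, hWS s h] at hs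
  refine ⟨G, H, ?_, fun s => (W s).1.2, fun s => (W s).2.2⟩
  ext s
  rw [HahnSeries.coeff_mul_of_support_subset hS hGS hHS]
  by_cases hs0 : s = 0
  · subst hs0
    rw [Finset.sum_eq_single (0, 0)]
    · simp [G, H, hW0, hgh]
    · intro p hp hne
      rw [Finset.mem_antidiagonal] at hp
      have h1 := hSnonneg _ hp.1
      have h2 := hSnonneg _ hp.2.1
      refine absurd (Prod.ext ?_ ?_) hne
      · exact ((add_eq_zero_iff_of_nonneg h1 h2).1 hp.2.2).1
      · exact ((add_eq_zero_iff_of_nonneg h1 h2).1 hp.2.2).2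
    · intro hn
      simp [hS0] at hn
  by_cases hsS : s ∉ S
  · rw [Finset.sum_eq_zero]
    · by_contra h
      exact hsS (hFS h)
    · intro p hp
      rw [Finset.mem_antidiagonal] at hp
      exact absurd (hp.2.2 ▸ hSadd _ hp.1 _ hp.2.1) hsS
  push Not at hsS
  set T : R := ∑ p ∈ Finset.antidiagonal hS hS s,
    if (p.1 < s ∧ p.1 ∈ S ∧ s ∈ S) ∧ (p.2 < s ∧ p.2 ∈ S ∧ s ∈ S) then
      ((W p.1).1 : R) * (W p.2).2 else 0 with hT
  have hWs : W s = sol (F.coeff s - T) := by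
    rw [hW]
    simp [step, hs0, hsS, hT]
  have key : g * (W s).2 + (W s).1 * h = F.coeff s - T := by
    rw [hWs]
    refine hsol _ (sub_mem (hM s) (sum_mem fun p _ => ?_))
    split_ifs
    · exact hmul _ (W p.1).1.2 _ (W p.2).2.2
    · exact zero_mem _
  have hsum : ∑ p ∈ Finset.antidiagonal hS hS s, G.coeff p.1 * H.coeff p.2 =
      ∑ p ∈ Finset.antidiagonal hS hS s,
        ((if (p.1 < s ∧ p.1 ∈ S ∧ s ∈ S) ∧ (p.2 < s ∧ p.2 ∈ S ∧ s ∈ S) then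
          ((W p.1).1 : R) * (W p.2).2 else 0) +
          (if p = (0, s) then g * (W s).2 else 0) + (if p = (s, 0) then (W s).1 * h else 0)) := by
    refine Finset.sum_congr rfl fun p hp => ?_
    obtain ⟨a, b⟩ := p
    rw [Finset.mem_antidiagonal] at hp
    obtain ⟨ha, hb, hab⟩ := hp
    dsimp only at ha hb hab ⊢
    have ha0 := hSnonneg _ ha
    have hb0 := hSnonneg _ hb
    rcases ha0.eq_or_lt with rfl | ha1
    · rw [zero_add] at hab
      subst hab
      simp [G, H, hW0, Ne.symm hs0]
    rcases hb0.eq_or_lt with rfl | hb1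
    · rw [add_zero] at hab
      subst hab
      simp [G, H, hW0, hs0]
    have h1 : a < s := by rw [← hab]; exact lt_add_of_pos_right _ hb1
    have h2 : b < s := by rw [← hab]; exact lt_add_of_pos_left _ ha1
    simp [G, H, h1, h2, ha, hb, hsS, ha1.ne', hb1.ne']
  rw [hsum, Finset.sum_add_distrib, Finset.sum_add_distrib, ← hT, Finset.sum_ite_eq',
    Finset.sum_ite_eq', if_pos (by simp [hS0, hsS]), if_pos (by simp [hS0, hsS]), add_assoc, key]
  ring

/-! ### Splitting polynomials into coprime factors -/

namespace Polynomial

theorem exists_taylor_coeff_eq_zero {K : Type*} [Field K] [CharZero K] (f : K[X])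
    (hf : 0 < f.natDegree) : ∃ r, (taylor r f).coeff (f.natDegree - 1) = 0 := by
  obtain ⟨n, hn⟩ : ∃ n, f.natDegree = n + 1 := ⟨f.natDegree - 1, by omega⟩
  have hl : f.coeff (n + 1) ≠ 0 := by
    rw [← hn, coeff_natDegree, leadingCoeff_ne_zero]
    rintro rfl
    simp at hf
  have hn0 : ((n : K) + 1) ≠ 0 := by exact_mod_cast n.succ_ne_zero
  -- This is the root of the linear polynomial `hasseDeriv n f`, as in the Tschirnhaus shift.
  refine ⟨-f.coeff n / ((n + 1) * f.coeff (n + 1)), ?_⟩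
  have hd : (hasseDeriv n f).natDegree ≤ 1 :=
    (natDegree_hasseDeriv_le f n).trans (by omega)
  rw [hn, Nat.add_sub_cancel, taylor_coeff, eq_X_add_C_of_natDegree_le_one hd]
  simp only [hasseDeriv_coeff, eval_add, eval_mul, eval_C, eval_X, zero_add, Nat.choose_self,
    add_comm 1 n, Nat.choose_succ_self_right]
  push_cast
  field_simp
  ring

/-- A non-monomial polynomial with an algebraically closed field of coefficients of characteristic
zero, whose subleading coefficient vanishes, is a product of coprime non-constant polynomials. -/
theorem exists_coprime_factorization {k : Type*} [Field k] [IsAlgClosed k] [CharZero k] (f : k[X])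
    (hn : 0 < f.natDegree) (hsub : f.coeff (f.natDegree - 1) = 0) {i : ℕ} (hi : i < f.natDegree)
    (hfi : f.coeff i ≠ 0) :
    ∃ g h : k[X], f = g * h ∧ IsCoprime g h ∧ 0 < g.natDegree ∧ 0 < h.natDegree := by
  have hf : f ≠ 0 := by rintro rfl; simp at hfi
  obtain ⟨c, hc⟩ := IsAlgClosed.exists_root f (by
    rw [degree_eq_natDegree hf]; exact_mod_cast hn.ne')
  obtain ⟨h, e, hd⟩ := exists_eq_pow_rootMultiplicity_mul_and_not_dvd f hf c
  have hm : 0 < f.rootMultiplicity c := (rootMultiplicity_pos hf).2 hc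
  refine ⟨_, h, e, ?_, ?_, ?_⟩
  · exact (((irreducible_X_sub_C c).coprime_iff_not_dvd).2 hd).pow_left
  · simpa using hm
  -- Otherwise `f = b (X - c)^m`, with subleading coefficient `-m b c`. Its vanishing forces `c = 0`
  -- in characteristic zero, so `f` would be a monomial.
  · by_contra h0
    obtain ⟨b, rfl⟩ := natDegree_eq_zero.1 (Nat.eq_zero_of_not_pos h0)
    have hb : b ≠ 0 := by
      rintro rfl
      simp at hd
    set m := f.rootMultiplicity c
    have hfm : f.natDegree = m := by
      rw [e, natDegree_mul_C hb]; simp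
    rw [hfm, e, coeff_mul_C, sub_eq_add_neg, ← C_neg, coeff_X_add_C_pow, Nat.sub_sub_self hm, pow_one,
      Nat.choose_symm hm, Nat.choose_one_right] at hsub
    have hc0 : c = 0 := by
      simpa [hb, hm.ne'] using hsub
    rw [e, hc0, coeff_mul_C] at hfi
    rw [hfm] at hi
    simp [coeff_X_pow, hi.ne] at hfi

end Polynomial

/-! ### Weighted expansion and Hensel's lemma -/

namespace HahnSeries

/-- The substitution `x ↦ x t^a`, as a ring homomorphism from polynomials over Hahn series to Hahn
series with polynomial coefficients. -/
noncomputable def weightedExpand {Γ k : Type*} [AddCommGroup Γ] [LinearOrder Γ] [IsOrderedAddMonoid Γ]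
    [CommRing k] (a : Γ) : (HahnSeries Γ k)[X] →+* HahnSeries Γ k[X] :=
  eval₂RingHom
    { toFun := fun x => x.map (Polynomial.C : k →+* k[X])
      map_zero' := by ext; simp
      map_one' := HahnSeries.map_one (Polynomial.C : k →+* k[X]).toMonoidWithZeroHom
      map_add' := fun _ _ => HahnSeries.map_add ((Polynomial.C : k →+* k[X]) : k →+ k[X])
      map_mul' := fun _ _ => HahnSeries.map_mul ((Polynomial.C : k →+* k[X]) : k →ₙ+* k[X]) }
    (single a X)

section CommRing

variable {Γ k : Type*} [AddCommGroup Γ] [LinearOrder Γ] [IsOrderedAddMonoid Γ] [CommRing k]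

theorem coeff_coeff_weightedExpand (a : Γ) (P : (HahnSeries Γ k)[X]) (s : Γ) (i : ℕ) :
    ((weightedExpand a P).coeff s).coeff i = (P.coeff i).coeff (s - i • a) := by
  induction P using Polynomial.induction_on' with
  | add p q hp hq => simp [hp, hq]
  | monomial n c =>
    have : (weightedExpand a (monomial n c)).coeff s = monomial n (c.coeff (s - n • a)) := by
      simp only [weightedExpand, coe_eval₂RingHom, eval₂_monomial, single_pow, coeff_mul_single]
      exact C_mul_X_pow_eq_monomial
    rw [this, coeff_monomial, coeff_monomial]
    split_ifs with h
    · rw [h]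
    · simp

theorem weightedExpand_injective (a : Γ) :
    Function.Injective (weightedExpand (k := k) a) := by
  intro P Q h
  ext i s
  have := coeff_coeff_weightedExpand a P (s + i • a) i
  rw [h, coeff_coeff_weightedExpand] at this
  simpa using this.symm

theorem exists_weightedExpand_eq (a : Γ) (F : HahnSeries Γ k[X]) (n : ℕ)
    (hF : ∀ s, (F.coeff s).natDegree ≤ n) :
    ∃ P : (HahnSeries Γ k)[X], P.natDegree ≤ n ∧ weightedExpand a P = F := by
  let c : ℕ → HahnSeries Γ k := fun i =>
    F.map (lcoeff k i).toAddMonoidHom * single (-(i • a)) 1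
  have hc : ∀ i s, (c i).coeff s = (F.coeff (s + i • a)).coeff i := fun i s => by
    simp [c, coeff_mul_single]
  refine ⟨∑ i ∈ Finset.range (n + 1), monomial i (c i), ?_, ?_⟩
  · refine natDegree_sum_le_of_forall_le _ _ fun i hi => ?_
    exact (natDegree_monomial_le _).trans (Nat.lt_succ_iff.1 (Finset.mem_range.1 hi))
  · ext s i
    rw [coeff_coeff_weightedExpand, finsetSum_coeff]
    simp only [coeff_monomial, Finset.sum_ite_eq', Finset.mem_range]
    split_ifs with h
    · simp [hc]
    · rw [coeff_zero, coeff_eq_zero_of_natDegree_lt]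
      exact (hF s).trans_lt (by omega)

end CommRing

/-- Hensel's lemma: a coprime factorization of the leading coefficient of a Hahn series with
polynomial coefficients lifts, with control of the degrees. -/
theorem exists_eq_mul_of_leadingCoeff_eq_mul {Γ k : Type*} [AddCommGroup Γ] [LinearOrder Γ]
    [IsOrderedAddMonoid Γ] [Field k] (F : HahnSeries Γ k[X]) (g h : k[X]) (hg : g ≠ 0)
    (hF : F.leadingCoeff = g * h) (hgh : IsCoprime g h)
    (hdeg : ∀ s, (F.coeff s).natDegree ≤ g.natDegree + h.natDegree) :
    ∃ G H : HahnSeries Γ k[X], F = G * H ∧ (∀ s, (G.coeff s).natDegree ≤ g.natDegree) ∧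
      ∀ s, (H.coeff s).natDegree ≤ h.natDegree := by
  have mem : ∀ (n : ℕ) (p : k[X]), p ∈ (degreeLE k n).toAddSubgroup ↔ p.natDegree ≤ n :=
    fun n p => by
      rw [Submodule.mem_toAddSubgroup, mem_degreeLE, natDegree_le_iff_degree_le]
  have hc : ∀ s, (single (-F.order) (1 : k[X]) * F).coeff s = F.coeff (s + F.order) := fun s => by
    rw [coeff_single_mul, one_mul, sub_neg_eq_add]
  obtain ⟨G, H, e, hG, hH⟩ := exists_eq_mul_of_coeff_zero_eq_mul
    (single (-F.order) (1 : k[X]) * F)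
    (fun s hs => by
      rw [hc]
      exact coeff_eq_zero_of_lt_order (by simpa using hs))
    (degreeLE k g.natDegree).toAddSubgroup (degreeLE k h.natDegree).toAddSubgroup
    (degreeLE k (g.natDegree + h.natDegree : ℕ)).toAddSubgroup g h
    ((mem _ _).2 le_rfl) ((mem _ _).2 le_rfl)
    (by rw [hc, zero_add, ← leadingCoeff_eq, hF])
    (fun s => by rw [hc, mem]; exact hdeg _)
    (fun x hx y hy => by
      rw [mem] at *
      exact natDegree_mul_le.trans (add_le_add hx hy))
    (fun w hw => by
      obtain ⟨a, b, hab⟩ := hgh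
      rw [mem] at hw
      -- The Bézout solution is reduced modulo `g` to bound the degree of `u`; the degree of `v` is
      -- then bounded through `g v = w - u h`.
      have hu : (w * b % g).natDegree ≤ g.natDegree :=
        natDegree_le_natDegree (degree_mod_lt _ hg).le
      have hw' : g * (w * a + w * b / g * h) + w * b % g * h = w := by
        linear_combination h * EuclideanDomain.div_add_mod (w * b) g + w * hab
      refine ⟨_, (mem _ _).2 hu, _, (mem _ _).2 ?_, hw'⟩
      by_cases hv : w * a + w * b / g * h = 0
      · rw [hv]; simp
      · have h1 := natDegree_mul hg hv
        rw [← add_le_add_iff_left g.natDegree, ← h1, eq_sub_of_add_eq hw']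
        refine (natDegree_sub_le _ _).trans (max_le hw (natDegree_mul_le.trans ?_))
        gcongr)
  refine ⟨single F.order 1 * G, H, ?_, fun s => ?_, fun s => (mem _ _).1 (hH s)⟩
  · rw [mul_assoc, ← e, ← mul_assoc, single_mul_single]
    simp
  · rw [coeff_single_mul, one_mul]
    exact (mem _ _).1 (hG _)

/-! ### Algebraic closedness of Hahn series fields -/

section IsAlgClosed

variable {Γ k : Type*} [Field Γ] [LinearOrder Γ] [IsStrictOrderedRing Γ] [Field k]

theorem order_eq_of_coeff {Γ R : Type*} [LinearOrder Γ] [Zero Γ] [Zero R] {x : HahnSeries Γ R}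
    {w : Γ} (hw : x.coeff w ≠ 0) (h : ∀ s < w, x.coeff s = 0) : x.order = w := by
  refine le_antisymm (order_le_of_coeff_ne_zero hw) ?_
  by_contra hlt
  have := h _ (not_le.1 hlt)
  rw [coeff_order_eq_zero] at this
  simp [this] at hw

-- After the shift that kills the subleading coefficient, the initial form along the last edge of
-- the Newton polygon is neither a monomial nor a power of a linear polynomial. It therefore has a
-- coprime factorization, which lifts to a factor of smaller positive degree.
open Classical in
theorem exists_isRoot_of_natDegree_pos [IsAlgClosed k] [CharZero k] (f : (HahnSeries Γ k)[X])
    (hf : 0 < f.natDegree) : ∃ z, f.eval z = 0 := by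
  induction hn : f.natDegree using Nat.strong_induction_on generalizing f with
  | _ n ih =>
  have : CharZero (HahnSeries Γ k) :=
    charZero_of_injective_ringHom (C_injective (Γ := Γ) (R := k))
  obtain ⟨r, hr⟩ := exists_taylor_coeff_eq_zero f hf
  suffices ∃ z, (taylor r f).eval z = 0 by
    obtain ⟨z, hz⟩ := this
    exact ⟨z + r, by rwa [taylor_eval] at hz⟩
  have hdeg : (taylor r f).natDegree = n := by rw [natDegree_taylor, hn]
  rw [hn] at hr hf
  generalize taylor r f = p at hr hdeg
  by_cases hall : ∀ i < n, p.coeff i = 0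
  · exact ⟨0, by rw [← coeff_zero_eq_eval_zero]; exact hall 0 hf⟩
  push Not at hall
  have hpn : p.coeff n ≠ 0 := by
    rw [← hdeg, coeff_natDegree, Polynomial.leadingCoeff_ne_zero]
    rintro rfl
    simp at hdeg
    omega
  -- The minimized quantity is minus the slope from `(i, v(c_i))` to `(n, v(c_n))`. The minimum
  -- selects the last edge, so `v(c_j) + j a` attains its minimum `w` at both `i` and `n`.
  obtain ⟨i, hi, hmin⟩ := Finset.exists_min_image
    ((Finset.range n).filter fun i => p.coeff i ≠ 0)
    (fun i => ((p.coeff i).order - (p.coeff n).order) / ((n : Γ) - i))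
    (by
      obtain ⟨i, hi, h⟩ := hall
      exact ⟨i, by simp [hi, h]⟩)
  simp only [Finset.mem_filter, Finset.mem_range] at hi hmin
  obtain ⟨hin, hpi⟩ := hi
  set a := ((p.coeff i).order - (p.coeff n).order) / ((n : Γ) - i) with ha
  set w := (p.coeff n).order + n * a with hw
  have hsub : ∀ j < n, (0 : Γ) < n - j := fun j hj => by
    rw [sub_pos]; exact_mod_cast hj
  have hwi : w = (p.coeff i).order + i * a := by
    have := (hsub i hin).ne'
    have : a * ((n : Γ) - i) = (p.coeff i).order - (p.coeff n).order := by
      rw [ha]; field_simp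
    rw [hw]; linear_combination this
  have hwle : ∀ j, p.coeff j ≠ 0 → w ≤ (p.coeff j).order + j * a := fun j hj => by
    rcases lt_trichotomy j n with h | rfl | h
    · have := hmin j ⟨h, hj⟩
      rw [le_div_iff₀ (hsub j h)] at this
      rw [hw]; linarith
    · exact le_rfl
    · exact absurd (coeff_eq_zero_of_natDegree_lt (by omega)) hj
  set F := weightedExpand a p with hF
  have hFc : ∀ s j, (F.coeff s).coeff j = (p.coeff j).coeff (s - j * a) := fun s j => by
    rw [hF, coeff_coeff_weightedExpand, nsmul_eq_mul]
  have hFn : (F.coeff w).coeff n ≠ 0 := by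
    rw [hFc, hw, add_sub_cancel_right, ne_eq, coeff_order_eq_zero]
    exact hpn
  have hFi : (F.coeff w).coeff i ≠ 0 := by
    rw [hFc, hwi, add_sub_cancel_right, ne_eq, coeff_order_eq_zero]
    exact hpi
  have hF1 : (F.coeff w).coeff (n - 1) = 0 := by rw [hFc, hr, coeff_zero]
  have hFdeg : ∀ s, (F.coeff s).natDegree ≤ n := fun s => by
    refine natDegree_le_iff_coeff_eq_zero.2 fun N hN => ?_
    rw [hFc, coeff_eq_zero_of_natDegree_lt (by omega), coeff_zero]
  have hord : F.order = w := by
    refine order_eq_of_coeff (fun h => by simp [h] at hFn) fun s hs => ?_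
    ext j
    rw [hFc, Polynomial.coeff_zero]
    by_cases hj : p.coeff j = 0
    · rw [hj, coeff_zero]
    · exact coeff_eq_zero_of_lt_order (by linarith [hwle j hj])
  have hwdeg : (F.coeff w).natDegree = n := natDegree_eq_of_le_of_coeff_ne_zero (hFdeg w) hFn
  obtain ⟨g, h, egh, hcop, hg, hh⟩ := exists_coprime_factorization (F.coeff w)
    (by omega) (by rwa [hwdeg]) (by rwa [hwdeg]) hFi
  have hg0 : g ≠ 0 := by rintro rfl; simp at hg
  have hh0 : h ≠ 0 := by rintro rfl; simp at hh
  have hsum : g.natDegree + h.natDegree = n := by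
    rw [← natDegree_mul hg0 hh0, ← egh, hwdeg]
  obtain ⟨G, H, e, hG, hH⟩ := exists_eq_mul_of_leadingCoeff_eq_mul F g h hg0
    (by rw [leadingCoeff_eq, hord, egh]) hcop (fun s => by rw [hsum]; exact hFdeg s)
  obtain ⟨p₁, hp₁, rfl⟩ := exists_weightedExpand_eq a G _ hG
  obtain ⟨p₂, hp₂, rfl⟩ := exists_weightedExpand_eq a H _ hH
  have hp : p = p₁ * p₂ := weightedExpand_injective a (by rw [map_mul, ← e])
  have := natDegree_mul_le (p := p₁) (q := p₂)
  rw [← hp, hdeg] at this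
  obtain ⟨z, hz⟩ := ih p₁.natDegree (by omega) p₁ (by omega) rfl
  exact ⟨z, by rw [hp, eval_mul, hz, zero_mul]⟩

instance isAlgClosed [IsAlgClosed k] [CharZero k] : IsAlgClosed (HahnSeries Γ k) :=
  IsAlgClosed.of_exists_root _ fun p _ hp => exists_isRoot_of_natDegree_pos p hp.natDegree_pos

end IsAlgClosed

end HahnSeries

/-! ### Parity of sign variations and of positive roots -/

namespace Polynomial

theorem trailingCoeff_monomial {R : Type*} [Semiring R] (n : ℕ) (c : R) :
    (monomial n c).trailingCoeff = c := by
  by_cases hc : c = 0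
  · simp [hc]
  · rw [trailingCoeff, natTrailingDegree_monomial hc, coeff_monomial, if_pos rfl]

theorem trailingCoeff_eraseLead {R : Type*} [Semiring R] {P : R[X]} (h : P.eraseLead ≠ 0) :
    P.eraseLead.trailingCoeff = P.trailingCoeff := by
  have hP : P ≠ 0 := by rintro rfl; simp at h
  have hne : P.eraseLead.natTrailingDegree ≠ P.natDegree := fun e => by
    have := coeff_natTrailingDegree_ne_zero.2 h
    rw [e, eraseLead_coeff, if_pos rfl] at this
    exact this rfl
  have h1 : P.coeff P.eraseLead.natTrailingDegree ≠ 0 := by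
    have := coeff_natTrailingDegree_ne_zero.2 h
    rwa [eraseLead_coeff_of_ne _ hne] at this
  have hlt : P.natTrailingDegree < P.natDegree :=
    (natTrailingDegree_le_of_ne_zero h1).trans_lt (lt_of_le_of_ne (le_natDegree_of_ne_zero h1) hne)
  have heq : P.eraseLead.natTrailingDegree = P.natTrailingDegree := by
    refine le_antisymm (natTrailingDegree_le_of_ne_zero ?_) (natTrailingDegree_le_of_ne_zero h1)
    rw [eraseLead_coeff_of_ne _ hlt.ne]
    exact coeff_natTrailingDegree_ne_zero.2 hP
  rw [trailingCoeff, trailingCoeff, heq, eraseLead_coeff_of_ne _ hlt.ne]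

/-- The parity of the number of sign variations is determined by the signs of the leading and the
trailing coefficient. -/
theorem sign_leadingCoeff_eq_neg_one_pow_signVariations_mul {R : Type*} [Semiring R]
    [LinearOrder R] (P : R[X]) :
    SignType.sign P.leadingCoeff = (-1) ^ P.signVariations * SignType.sign P.trailingCoeff := by
  induction hn : P.support.card using Nat.strong_induction_on generalizing P with
  | _ n ih =>
  by_cases hP : P = 0
  · simp [hP]
  by_cases h : P.eraseLead = 0
  · have := P.eraseLead_add_monomial_natDegree_leadingCoeff
    rw [h, zero_add] at this
    rw [← this]
    simp [trailingCoeff_monomial]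
  have := ih _ (hn ▸ eraseLead_support_card_lt hP) P.eraseLead rfl
  rw [trailingCoeff_eraseLead h] at this
  -- Removing the leading monomial loses a variation exactly when the two top signs are opposite.
  rw [signVariations_eq_eraseLead_add_ite hP]
  have h1 : SignType.sign P.leadingCoeff ≠ 0 := by simpa using hP
  have h2 : SignType.sign P.eraseLead.leadingCoeff ≠ 0 := by simpa using h
  rw [pow_add, mul_right_comm, ← this]
  generalize SignType.sign P.leadingCoeff = s at *
  generalize SignType.sign P.eraseLead.leadingCoeff = t at *
  clear this
  split_ifs with hst <;> revert s t <;> decide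

/-- Without real roots, the value at `0` has the sign of the behaviour at `+∞`, by the intermediate
value theorem. -/
theorem sign_leadingCoeff_eq_sign_trailingCoeff_of_roots_eq_zero {q : ℝ[X]} (hq : q ≠ 0)
    (h : q.roots = 0) : SignType.sign q.leadingCoeff = SignType.sign q.trailingCoeff := by
  have hroot : ∀ x, q.eval x ≠ 0 := fun x hx => by
    have : x ∈ q.roots := (mem_roots hq).2 hx
    simp [h] at this
  have key : ∀ p : ℝ[X], (∀ x, p.eval x ≠ 0) → 0 < p.leadingCoeff → 0 < p.eval 0 := by
    intro p hp hl
    by_contra hneg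
    have h0 : p.eval 0 ≤ 0 := not_lt.1 hneg
    have hdeg : 0 < p.degree := by
      by_contra hd
      rw [eq_C_of_degree_le_zero (not_lt.1 hd)] at hl h0
      simp at hl h0
      linarith
    have ht := p.tendsto_atTop_of_leadingCoeff_nonneg hdeg hl.le
    obtain ⟨x, hx1, hx0⟩ := ((ht.eventually_ge_atTop 0).and (Filter.eventually_ge_atTop 0)).exists
    obtain ⟨y, -, hy⟩ := intermediate_value_Icc hx0 p.continuous.continuousOn ⟨h0, hx1⟩
    exact hp y hy
  have ht : q.trailingCoeff = q.eval 0 := by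
    rw [← coeff_zero_eq_eval_zero]
    exact trailingCoeff_eq_coeff_zero (by rw [coeff_zero_eq_eval_zero]; exact hroot 0)
  rw [ht]
  rcases lt_or_gt_of_ne (leadingCoeff_ne_zero.2 hq) with hl | hl
  · have := key (-q) (fun x => by simpa using hroot x) (by simpa using hl)
    rw [sign_neg hl, sign_neg (by simpa using this)]
  · rw [sign_pos hl, sign_pos (key q hroot hl)]

/-- The parity of the number of positive roots of a real polynomial is determined by the signs of
the leading and the trailing coefficient. -/
theorem sign_leadingCoeff_eq_neg_one_pow_countP_roots_mul (q : ℝ[X]) :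
    SignType.sign q.leadingCoeff =
      (-1) ^ q.roots.countP (0 < ·) * SignType.sign q.trailingCoeff := by
  by_cases hq : q = 0
  · simp [hq]
  obtain ⟨p, hp, -, hr⟩ := q.exists_prod_multiset_X_sub_C_mul
  have hp0 : p ≠ 0 := by rintro rfl; simp at hp; exact hq hp.symm
  -- The multiset is freed from `q` so that linear factors can be added one by one to the fixed
  -- rootless cofactor `p`. Only a factor with `a > 0` flips the trailing sign.
  suffices ∀ s : Multiset ℝ,
      SignType.sign ((s.map fun a => X - C a).prod * p).leadingCoeff =
        (-1) ^ s.countP (0 < ·) *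
          SignType.sign ((s.map fun a => X - C a).prod * p).trailingCoeff by
    have := this q.roots
    rwa [hp] at this
  intro s
  induction s using Multiset.induction_on with
  | empty => simpa using sign_leadingCoeff_eq_sign_trailingCoeff_of_roots_eq_zero hp0 hr
  | cons a s ih =>
    rw [Multiset.map_cons, Multiset.prod_cons, mul_assoc, leadingCoeff_mul, leadingCoeff_X_sub_C,
      one_mul, ih, trailingCoeff_mul (X - C a), sign_mul]
    rcases eq_or_ne a 0 with rfl | ha
    · have : (X - C 0 : ℝ[X]).trailingCoeff = 1 := by
        rw [C_0, sub_zero, ← monomial_one_one_eq_X, trailingCoeff_monomial]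
      rw [this]
      simp
    · have : (X - C a : ℝ[X]).trailingCoeff = -a := by
        rw [trailingCoeff_eq_coeff_zero] <;> simp [ha]
      rw [this]
      rcases lt_or_gt_of_ne ha with h | h
      · rw [Multiset.countP_cons_of_neg _ (not_lt.2 h.le), sign_pos (neg_pos.2 h)]
        simp
      · rw [Multiset.countP_cons_of_pos _ h, sign_neg (neg_neg_of_pos h), pow_succ]
        simp

open Classical in
theorem countP_roots_map_ofRealHom {q : ℝ[X]} (hq : q ≠ 0) :
    (q.map Complex.ofRealHom).roots.countP (fun z : ℂ => ∃ c : ℝ, 0 < c ∧ z = c) =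
      q.roots.countP (0 < ·) := by
  obtain ⟨p, hp, -, hr⟩ := q.exists_prod_multiset_X_sub_C_mul
  have hp0 : p ≠ 0 := by rintro rfl; simp at hp; exact hq hp.symm
  have hmap : q.map Complex.ofRealHom =
      ((q.roots.map Complex.ofRealHom).map fun a => X - C a).prod * p.map Complex.ofRealHom := by
    conv_lhs => rw [← hp]
    rw [Polynomial.map_mul, Polynomial.map_multiset_prod, Multiset.map_map, Multiset.map_map]
    simp
  have hne : q.map Complex.ofRealHom ≠ 0 :=
    (Polynomial.map_ne_zero_iff Complex.ofRealHom.injective).2 hq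
  have h0 : (p.map Complex.ofRealHom).roots.countP (fun z : ℂ => ∃ c : ℝ, 0 < c ∧ z = c) = 0 := by
    rw [Multiset.countP_eq_zero]
    rintro z hz ⟨c, -, rfl⟩
    have h1 : c ∈ p.roots := by
      rw [mem_roots hp0, IsRoot.def]
      have := isRoot_of_mem_roots hz
      rw [IsRoot.def, ← Complex.ofRealHom_eq_coe, eval_map_apply] at this
      exact (map_eq_zero _).1 this
    simp [hr] at h1
  rw [hmap, roots_mul (hmap ▸ hne), roots_multiset_prod_X_sub_C, Multiset.countP_add, h0, add_zero,
    Multiset.countP_map, Multiset.countP_eq_card_filter]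
  congr 1
  refine Multiset.filter_congr fun r _ => ⟨?_, fun h => ⟨r, h, rfl⟩⟩
  rintro ⟨c, hc, e⟩
  have : r = c := Complex.ofReal_injective e
  rwa [this]

end Polynomial

/-! ### Initial forms and roots with positive leading term -/

namespace HahnSeries

theorem coeff_weightedExpand_X_sub_C {Γ k : Type*} [AddCommGroup Γ] [LinearOrder Γ]
    [IsOrderedAddMonoid Γ] [CommRing k] (a : Γ) (z : HahnSeries Γ k) (s : Γ) :
    (weightedExpand a (X - Polynomial.C z)).coeff s =
      (if s = a then X else 0) - Polynomial.C (z.coeff s) := by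
  rw [map_sub, coeff_sub]
  congr 1
  · simp [weightedExpand, coeff_single]
  · simp only [weightedExpand, coe_eval₂RingHom, eval₂_C]
    rfl

/-- The terms `X t^a` and `z` compete for the lowest exponent. When `v(z) > a`, including `z = 0`,
the coefficient of `z` at `a` is zero and the result is `X`. -/
theorem leadingCoeff_weightedExpand_X_sub_C {Γ k : Type*} [AddCommGroup Γ] [LinearOrder Γ]
    [IsOrderedAddMonoid Γ] [Field k] (a : Γ) (z : HahnSeries Γ k) :
    (weightedExpand a (X - Polynomial.C z)).leadingCoeff =
      if (a : WithTop Γ) ≤ z.orderTop then X - Polynomial.C (z.coeff a)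
      else Polynomial.C (-z.leadingCoeff) := by
  split_ifs with h
  · have hc : (weightedExpand a (X - Polynomial.C z)).coeff a = X - Polynomial.C (z.coeff a) := by
      rw [coeff_weightedExpand_X_sub_C, if_pos rfl]
    have ho : (weightedExpand a (X - Polynomial.C z)).order = a := by
      refine order_eq_of_coeff (by rw [hc]; exact X_sub_C_ne_zero _) fun s hs => ?_
      rw [coeff_weightedExpand_X_sub_C, if_neg hs.ne, coeff_eq_zero_of_lt_orderTop]
      · simp
      · exact (WithTop.coe_lt_coe.2 hs).trans_le h
    rw [leadingCoeff_eq, ho, hc]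
  · have hz : z ≠ 0 := by rintro rfl; simp at h
    have hlt : z.order < a := by
      rw [← order_eq_orderTop_of_ne_zero hz, not_le] at h
      exact WithTop.coe_lt_coe.1 h
    have hc : (weightedExpand a (X - Polynomial.C z)).coeff z.order =
        Polynomial.C (-z.leadingCoeff) := by
      rw [coeff_weightedExpand_X_sub_C, if_neg hlt.ne, leadingCoeff_eq]
      simp
    have ho : (weightedExpand a (X - Polynomial.C z)).order = z.order := by
      refine order_eq_of_coeff ?_ fun s hs => ?_
      · rw [hc]
        simpa using hz
      · rw [coeff_weightedExpand_X_sub_C, if_neg (hs.trans hlt).ne, coeff_eq_zero_of_lt_order hs]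
        simp
    rw [leadingCoeff_eq, ho, hc]

end HahnSeries

open Classical in
theorem countP_roots_leadingCoeff_weightedExpand_X_sub_C (a : ℝ) (z : ComplexHahn) :
    ((HahnSeries.weightedExpand a (X - C z)).leadingCoeff).roots.countP
      (fun z : ℂ => ∃ c : ℝ, 0 < c ∧ z = c) = if HasPosLeadingTerm z a then 1 else 0 := by
  rw [HahnSeries.leadingCoeff_weightedExpand_X_sub_C]
  split_ifs with h1 h2 h2
  · obtain ⟨ho, c, hc, hl⟩ := h2
    have hz : z ≠ 0 := by rintro rfl; simp at ho
    have : z.order = a := by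
      rw [← HahnSeries.order_eq_orderTop_of_ne_zero hz] at ho
      exact WithTop.coe_inj.1 ho
    rw [roots_X_sub_C, ← Multiset.cons_zero, Multiset.countP_cons_of_pos, Multiset.countP_zero]
    exact ⟨c, hc, by rw [← hl, HahnSeries.leadingCoeff_eq, this]⟩
  · rw [roots_X_sub_C, ← Multiset.cons_zero, Multiset.countP_cons_of_neg, Multiset.countP_zero]
    rintro ⟨c, hc, e⟩
    have hne : z.coeff a ≠ 0 := by rw [e]; exact_mod_cast hc.ne'
    have ho : z.orderTop = a := le_antisymm (HahnSeries.orderTop_le_of_coeff_ne_zero hne) h1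
    have hz : z ≠ 0 := HahnSeries.ne_zero_of_coeff_ne_zero hne
    have : z.order = a := by
      rw [← HahnSeries.order_eq_orderTop_of_ne_zero hz] at ho
      exact WithTop.coe_inj.1 ho
    exact h2 ⟨ho, c, hc, by rw [HahnSeries.leadingCoeff_eq, this, e]⟩
  · exact absurd h2.1.ge h1
  · rw [roots_C, Multiset.countP_zero]

open Classical in
/-- The positive roots of the initial form of a complex polynomial are counted by its roots with
positive leading term. -/
theorem countP_roots_leadingCoeff_weightedExpand (a : ℝ) {P : ComplexHahn[X]} (hP : P ≠ 0) :
    ((HahnSeries.weightedExpand a P).leadingCoeff).roots.countP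
      (fun z : ℂ => ∃ c : ℝ, 0 < c ∧ z = c) = P.roots.countP (fun z => HasPosLeadingTerm z a) := by
  have key : ∀ (c : ComplexHahn), c ≠ 0 → ∀ s : Multiset ComplexHahn,
      ((HahnSeries.weightedExpand a (C c * (s.map fun z => X - C z).prod)).leadingCoeff).roots.countP
        (fun z : ℂ => ∃ c : ℝ, 0 < c ∧ z = c) = s.countP (fun z => HasPosLeadingTerm z a) := by
    intro c hc s
    induction s using Multiset.induction_on with
    | empty =>
      have hd : (HahnSeries.weightedExpand a (C c)).leadingCoeff.natDegree = 0 := by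
        rw [← Nat.le_zero, natDegree_le_iff_coeff_eq_zero]
        intro N hN
        rw [HahnSeries.leadingCoeff_eq, HahnSeries.coeff_coeff_weightedExpand, coeff_C,
          if_neg hN.ne', HahnSeries.coeff_zero]
      rw [Multiset.map_zero, Multiset.prod_zero, mul_one, eq_C_of_natDegree_eq_zero hd, roots_C]
      simp
    | cons z s ih =>
      have hne : C c * (s.map fun z => X - C z).prod ≠ 0 :=
        mul_ne_zero (C_ne_zero.2 hc) (monic_multiset_prod_of_monic _ _
          fun z _ => monic_X_sub_C z).ne_zero
      have hinj := HahnSeries.weightedExpand_injective (k := ℂ) a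
      have hcomm : C c * ((X - C z) * (s.map fun z => X - C z).prod) =
          (X - C z) * (C c * (s.map fun z => X - C z).prod) := by ring
      rw [Multiset.map_cons, Multiset.prod_cons, hcomm, map_mul,
        HahnSeries.leadingCoeff_mul, roots_mul, Multiset.countP_add, ih,
        countP_roots_leadingCoeff_weightedExpand_X_sub_C, Multiset.countP_cons, add_comm]
      exact mul_ne_zero
        (HahnSeries.leadingCoeff_ne_zero.2 ((map_ne_zero_iff _ hinj).2 (X_sub_C_ne_zero z)))
        (HahnSeries.leadingCoeff_ne_zero.2 ((map_ne_zero_iff _ hinj).2 hne))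
  have hs := (IsAlgClosed.splits P).eq_prod_roots
  conv_lhs => rw [hs]
  exact key _ (leadingCoeff_ne_zero.2 hP) _

/-! ### Signs of the initial form and conclusion -/

theorem RealHahn.coeff_toComplex (x : RealHahn) (s : ℝ) :
    (RealHahn.toComplex x).coeff s = ((ofLex x).coeff s : ℂ) := rfl

theorem RealHahn.sign_eq (x : RealHahn) :
    SignType.sign x = SignType.sign (ofLex x).leadingCoeff := by
  rcases lt_trichotomy x 0 with h | rfl | h
  · rw [sign_neg h, sign_neg (HahnSeries.leadingCoeff_neg_iff.2 h)]
  · simp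
  · rw [sign_pos h, sign_pos (HahnSeries.leadingCoeff_pos_iff.2 h)]

open Classical in
theorem coeff_initialForm (a : ℝ) (P : RealHahn[X]) (i : ℕ) :
    (initialForm a P).coeff i =
      if ∀ j : ℕ, (P.coeff i).val + ((a * i : ℝ) : WithTop ℝ) ≤
        (P.coeff j).val + ((a * j : ℝ) : WithTop ℝ) then P.coeff i else 0 := by
  rw [initialForm, finsetSum_coeff]
  simp only [coeff_monomial, Finset.sum_ite_eq', Finset.mem_filter, mem_support_iff]
  split_ifs with h1 h2 h2
  · rfl
  · exact absurd h1.2 h2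
  · by_contra h
    exact h1 ⟨fun e => h e.symm, h2⟩
  · rfl

theorem Polynomial.support_eq_of_sign_coeff_eq {R S : Type*} [Semiring R] [LinearOrder R]
    [Semiring S] [LinearOrder S] {p : R[X]} {q : S[X]}
    (h : ∀ i, SignType.sign (p.coeff i) = SignType.sign (q.coeff i)) : p.support = q.support := by
  ext i
  rw [mem_support_iff, mem_support_iff, ← sign_ne_zero, h, sign_ne_zero]

/-- The leading coefficients of the coefficients of the initial form are the coefficients of a real
polynomial, the leading coefficient of the weighted expansion. -/
theorem exists_real_initialForm (a : ℝ) {P : RealHahn[X]} (hP : P ≠ 0) :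
    ∃ q : ℝ[X], q ≠ 0 ∧
      (HahnSeries.weightedExpand a (P.map RealHahn.toComplex)).leadingCoeff =
        q.map Complex.ofRealHom ∧
      ∀ i, SignType.sign ((initialForm a P).coeff i) = SignType.sign (q.coeff i) := by
  set F := HahnSeries.weightedExpand a (P.map RealHahn.toComplex) with hF
  have hF0 : F ≠ 0 := (map_ne_zero_iff _ (HahnSeries.weightedExpand_injective a)).2
    ((Polynomial.map_ne_zero_iff RealHahn.toComplex.injective).2 hP)
  have hFc : ∀ s i, (F.coeff s).coeff i = ((ofLex (P.coeff i)).coeff (s - a * i) : ℂ) :=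
    fun s i => by
      rw [hF, HahnSeries.coeff_coeff_weightedExpand, coeff_map, RealHahn.coeff_toComplex,
        nsmul_eq_mul, mul_comm a]
  set w := F.order with hw
  have hle : ∀ i : ℕ, ((w - a * i : ℝ) : WithTop ℝ) ≤ (P.coeff i).val := fun i => by
    rw [RealHahn.val, HahnSeries.le_orderTop_iff_forall]
    intro s hs
    have hs' : s + a * i < F.order := by
      have := WithTop.coe_lt_coe.1 hs
      linarith
    have := hFc (s + a * i) i
    rw [HahnSeries.coeff_eq_zero_of_lt_order hs', coeff_zero, add_sub_cancel_right] at this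
    exact_mod_cast this.symm
  have hadd : ∀ i : ℕ, ((w : ℝ) : WithTop ℝ) =
      ((w - a * i : ℝ) : WithTop ℝ) + ((a * i : ℝ) : WithTop ℝ) := fun i => by
    rw [← WithTop.coe_add, sub_add_cancel]
  obtain ⟨i₀, hi₀⟩ : ∃ i : ℕ, (P.coeff i).val = ((w - a * i : ℝ) : WithTop ℝ) := by
    have h1 : F.coeff w ≠ 0 := fun h => hF0 (HahnSeries.coeff_order_eq_zero.1 h)
    obtain ⟨i, hi⟩ : ∃ i, (F.coeff w).coeff i ≠ 0 := by
      by_contra! h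
      exact h1 (ext fun i => by rw [h, coeff_zero])
    refine ⟨i, le_antisymm (HahnSeries.orderTop_le_of_coeff_ne_zero fun h => hi ?_) (hle i)⟩
    rw [hFc, h, Complex.ofReal_zero]
  -- The order `w` of the expansion is the minimum of `v(c_i) + a i`, attained at `i₀`, so
  -- minimality amounts to attaining `w`.
  have hcond : ∀ i : ℕ, (∀ j : ℕ, (P.coeff i).val + ((a * i : ℝ) : WithTop ℝ) ≤
      (P.coeff j).val + ((a * j : ℝ) : WithTop ℝ)) ↔
      (P.coeff i).val = ((w - a * i : ℝ) : WithTop ℝ) := fun i => by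
    constructor
    · intro h
      refine le_antisymm ?_ (hle i)
      have := h i₀
      rw [hi₀, ← hadd, hadd i] at this
      exact (WithTop.add_le_add_iff_right WithTop.coe_ne_top).1 this
    · intro h j
      rw [h, ← hadd, hadd j]
      gcongr
      exact hle j
  let q : ℝ[X] := ∑ i ∈ P.support, monomial i ((ofLex (P.coeff i)).coeff (w - a * i))
  have hq : ∀ i, q.coeff i = (ofLex (P.coeff i)).coeff (w - a * i) := fun i => by
    simp only [q, finsetSum_coeff, coeff_monomial, Finset.sum_ite_eq', mem_support_iff]
    split_ifs with h
    · rfl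
    · rw [not_not.1 h]; rfl
  have hmap : F.leadingCoeff = q.map Complex.ofRealHom := by
    ext i
    rw [HahnSeries.leadingCoeff_eq, hFc, coeff_map, hq]
    rfl
  refine ⟨q, ?_, hmap, fun i => ?_⟩
  · rintro h
    rw [h, Polynomial.map_zero, HahnSeries.leadingCoeff_eq_zero] at hmap
    exact hF0 hmap
  · rw [coeff_initialForm, hq]
    by_cases h : (P.coeff i).val = ((w - a * i : ℝ) : WithTop ℝ)
    · rw [if_pos ((hcond i).2 h), RealHahn.sign_eq]
      have hne : ofLex (P.coeff i) ≠ 0 := by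
        rw [← HahnSeries.orderTop_ne_top]
        exact ne_of_eq_of_ne h WithTop.coe_ne_top
      have : (ofLex (P.coeff i)).order = w - a * i := by
        rw [← WithTop.coe_inj, HahnSeries.order_eq_orderTop_of_ne_zero hne]
        exact h
      rw [HahnSeries.leadingCoeff_eq, this]
    · rw [if_neg (fun h' => h ((hcond i).1 h')), HahnSeries.coeff_eq_zero_of_lt_orderTop]
      · simp
      · exact lt_of_le_of_ne (hle i) (Ne.symm h)

/-- Descartes' rule of signs modulo 2 for a weight of a polynomial over the Hahn series. -/
theorem signVariations_initialForm_modEq (a : ℝ) {P : RealHahn[X]} (hP : P ≠ 0) :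
    (initialForm a P).signVariations ≡ numPosLeadingRoots P a [MOD 2] := by
  obtain ⟨q, hq, hmap, hsign⟩ := exists_real_initialForm a hP
  have hP' : P.map RealHahn.toComplex ≠ 0 :=
    (Polynomial.map_ne_zero_iff RealHahn.toComplex.injective).2 hP
  rw [numPosLeadingRoots, ← countP_roots_leadingCoeff_weightedExpand a hP', hmap,
    countP_roots_map_ofRealHom hq]
  have hsupp := support_eq_of_sign_coeff_eq hsign
  have h1 := sign_leadingCoeff_eq_neg_one_pow_signVariations_mul (initialForm a P)
  have h2 := sign_leadingCoeff_eq_neg_one_pow_countP_roots_mul q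
  have hd : (initialForm a P).natDegree = q.natDegree := by
    rw [natDegree_eq_support_max' hq, natDegree_eq_support_max' (by
      rwa [ne_eq, ← support_eq_empty, hsupp, support_eq_empty])]
    simp only [hsupp]
  have ht : (initialForm a P).natTrailingDegree = q.natTrailingDegree := by
    rw [natTrailingDegree_eq_support_min' hq, natTrailingDegree_eq_support_min' (by
      rwa [ne_eq, ← support_eq_empty, hsupp, support_eq_empty])]
    simp only [hsupp]
  rw [leadingCoeff, trailingCoeff, hd, ht, hsign, hsign, coeff_natDegree, h2, trailingCoeff] at h1
  have hne : SignType.sign (q.coeff q.natTrailingDegree) ≠ 0 := by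
    rw [sign_ne_zero]
    exact coeff_natTrailingDegree_ne_zero.2 hq
  generalize SignType.sign (q.coeff q.natTrailingDegree) = t at h1 hne
  generalize (initialForm a P).signVariations = m at h1 ⊢
  generalize q.roots.countP (0 < ·) = n at h1 ⊢
  have h3 : ((-1 : SignType)) ≠ 1 := by decide
  have h4 := mul_right_cancel₀ hne h1
  -- Cancelling the nonzero trailing sign has left an equality of powers of `-1` with exponents `m`
  -- and `n`, which decides the parity.
  rw [Nat.ModEq]
  rcases Nat.even_or_odd m with hm | hm <;> rcases Nat.even_or_odd n with hn | hn
  · rw [Nat.even_iff.1 hm, Nat.even_iff.1 hn]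
  · rw [hm.neg_one_pow, hn.neg_one_pow] at h4
    exact absurd h4 h3
  · rw [hm.neg_one_pow, hn.neg_one_pow] at h4
    exact absurd h4.symm h3
  · rw [Nat.odd_iff.1 hm, Nat.odd_iff.1 hn]

theorem mainTheorem4 (P : Polynomial RealHahn) (σ : Set (ℝ × ℝ)) (lam : ℝ)
    (hσ : IsNewtonEdge P σ lam) :
    (initialForm (-lam) P).signVariations ≡ numPosLeadingRoots P (-lam) [MOD 2] := by
  by_cases hP : P = 0
  · subst hP
    simp [initialForm, numPosLeadingRoots, Nat.ModEq]
  · exact signVariations_initialForm_modEq (-lam) hP
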